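/- Let $k$ be a field, $n\ge 0$, and let $\mathbb P^{n+2}$ have coordinates $x,y,z,z_1,\dots,z_n$ over $k$. Let $X=\{x=y=0\}$ and $Z=\{z=y=0\}$, two linear subspaces of codimension two contained in the hyperplane $H=\{y=0\}$. Let $J_1$ (resp. $J_2$) be a saturated ideal of $S=k[x,y,z,z_1,\dots,z_n]$ that is generated by monomials, has radical $(x,y)$ (resp. $(z,y)$), and defines a (locally) Cohen–Macaulay closed subscheme of $\mathbb P^{n+2}$. Let $T_1$ be the Young diagram that has a box in row $s$ and column $r$ ($r,s\ge 0$) if and only if $x^ry^s\notin J_1$, and let $T_2$ be the Young diagram that has a box in row $s$ and column $r$ if and only if $z^ry^s\notin J_2$. In $\mathbb P^{n+2}_{k[t]}=\mathbb P^{n+2}\times\mathbb A^1$ let $\mathcal Y$ be the scheme-theoretic union of the closed subscheme $V(J_1)\times\mathbb A^1$ and of the closed subscheme whose ideal is generated by the image of $J_2$ under the substitution $z\mapsto tz+(1-t)x$ (the other coordinates being fixed). Then: 1. $\mathcal Y\to\mathbb A^1=\operatorname{Spec}k[t]$ is flat. 2. For every field extension $K/k$ and every $t_0\in K$ with $t_0\ne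 0$, the fibre $\mathcal Y_{t_0}\subset\mathbb P^{n+2}_K$ is the scheme-theoretic union of $V(J_1)_K$ and of the closed subscheme obtained from $J_2$ by the substitution $z\mapsto t_0z+(1-t_0)x$. 3. The special fibre $\mathcal Y_0$ (over $k$, and over every extension $K$ of $k$) is the closed subscheme defined by the monomial ideal whose Young diagram is the row-wise sum $T_1+T_2$, i.e. the ideal generated by the monomials $x^ry^s$ with $r\ge\lambda_s+\mu_s$, where $\lambda_s$ and $\mu_s$ are the numbers of boxes in row $s$ of $T_1$ and of $T_2$. -/

import Mathlib

open AlgebraicGeometry CategoryTheory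

universe u

attribute [local instance] MvPolynomial.gradedAlgebra

/-- The row-wise sum of two Young diagrams: its `i`-th row has
`T.rowLen i + T'.rowLen i` boxes. -/
def YoungDiagram.rowSum (T T' : YoungDiagram) : YoungDiagram where
  cells := (Finset.range (T.colLen 0 + T'.colLen 0) ×ˢ
    Finset.range (T.rowLen 0 + T'.rowLen 0)).filter
      fun c => c.2 < T.rowLen c.1 + T'.rowLen c.1
  isLowerSet := by
    rintro ⟨i, j⟩ ⟨i', j'⟩ ⟨h₁, h₂⟩ hij
    simp only [Finset.coe_filter, Finset.mem_product, Finset.mem_range,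
      Set.mem_ofPred_eq] at hij ⊢
    dsimp only at h₁ h₂
    have := T.rowLen_anti _ _ h₁
    have := T'.rowLen_anti _ _ h₁
    omega

/-- The length of each row of the row-wise sum is the sum of the lengths of the rows. -/
theorem YoungDiagram.rowLen_rowSum (T T' : YoungDiagram) (i : ℕ) :
    (T.rowSum T').rowLen i = T.rowLen i + T'.rowLen i := by
  have key : ∀ j, j < (T.rowSum T').rowLen i ↔ j < T.rowLen i + T'.rowLen i := by
    intro j
    rw [← YoungDiagram.mem_iff_lt_rowLen, ← YoungDiagram.mem_cells]
    simp only [YoungDiagram.rowSum, Finset.mem_filter, Finset.mem_product, Finset.mem_range,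
      and_iff_right_iff_imp]
    intro hj
    have h₁ := T.rowLen_anti _ _ (Nat.zero_le i)
    have h₂ := T'.rowLen_anti _ _ (Nat.zero_le i)
    refine ⟨?_, by omega⟩
    rcases Nat.eq_zero_or_pos (T.rowLen i) with h | h
    · have h' : 0 < T'.rowLen i := by omega
      have : i < T'.colLen 0 := by
        rwa [← YoungDiagram.mem_iff_lt_colLen, YoungDiagram.mem_iff_lt_rowLen]
      omega
    · have : i < T.colLen 0 := by
        rwa [← YoungDiagram.mem_iff_lt_colLen, YoungDiagram.mem_iff_lt_rowLen]
      omega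
  exact eq_of_forall_lt_iff key

/-- A Cohen-Macaulay local ring: a noetherian local ring with a regular sequence, contained in
the maximal ideal, whose length is the Krull dimension. -/
def IsCohenMacaulayLocalRing (R : Type u) [CommRing R] : Prop :=
  IsNoetherianRing R ∧ IsLocalRing R ∧ ∃ rs : List R, (∀ r ∈ rs, r ∈ nonunits R) ∧
    RingTheory.Sequence.IsRegular R rs ∧ ringKrullDim R = rs.length

namespace ProjSpace

noncomputable section

/-- The standard grading of `R[X₀, …, X_N]`. -/
abbrev grading (R : Type u) [CommRing R] (N : ℕ) :
    ℕ → Submodule R (MvPolynomial (Fin (N + 1)) R) :=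
  MvPolynomial.homogeneousSubmodule (Fin (N + 1)) R

/-- The projective space `ℙ^N` over `R`. -/
abbrev space (R : Type u) [CommRing R] (N : ℕ) : Scheme.{u} := Proj (grading R N)

/-- The structure morphism `ℙ^N_R ⟶ Spec R`. -/
def toSpec (R : Type u) [CommRing R] (N : ℕ) : space R N ⟶ Spec (.of R) :=
  Proj.toSpecZero (grading R N) ≫
    Spec.map (CommRingCat.ofHom (algebraMap R (grading R N 0)))

/-- Applying a ring homomorphism to the coefficients, as a graded ring homomorphism. -/
def gradedMap {R R' : Type u} [CommRing R] [CommRing R'] (f : R →+* R') (N : ℕ) :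
    grading R N →+*ᵍ grading R' N where
  __ := MvPolynomial.map (σ := Fin (N + 1)) f
  map_mem h := MvPolynomial.IsHomogeneous.map h f

theorem irrelevant_le_map {R R' : Type u} [CommRing R] [CommRing R'] (f : R →+* R') (N : ℕ) :
    HomogeneousIdeal.irrelevant (grading R' N) ≤
      (HomogeneousIdeal.irrelevant (grading R N)).map (gradedMap f N) := by
  rw [HomogeneousIdeal.irrelevant_le]
  intro d hd p hp
  change p ∈ Ideal.map _ _
  rw [p.as_sum]
  refine Ideal.sum_mem _ fun m hm => ?_
  have hdeg : m.degree = d := by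
    have := hp (MvPolynomial.mem_support_iff.mp hm)
    rwa [Finsupp.degree_eq_weight_one]
  obtain ⟨i, hi⟩ : ∃ i, m i ≠ 0 := by
    by_contra! h
    have : m = 0 := Finsupp.ext h
    subst this
    simp at hdeg
    omega
  have hX : (MvPolynomial.X i : MvPolynomial (Fin (N + 1)) R') ∈
      Ideal.map (gradedMap f N) (HomogeneousIdeal.irrelevant (grading R N)).toIdeal := by
    have hXR : (MvPolynomial.X i : MvPolynomial (Fin (N + 1)) R) ∈
        (HomogeneousIdeal.irrelevant (grading R N)).toIdeal :=
      HomogeneousIdeal.mem_irrelevant_of_mem _ Nat.zero_lt_one (MvPolynomial.isHomogeneous_X R i)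
    have := Ideal.mem_map_of_mem (gradedMap f N) hXR
    have e : gradedMap f N (MvPolynomial.X i) = MvPolynomial.X i :=
      MvPolynomial.map_X f i
    rwa [e] at this
  refine Ideal.mem_of_dvd _ ?_ hX
  rw [MvPolynomial.X_dvd_monomial]
  exact Or.inr hi

/-- The base change morphism `ℙ^N_{R'} ⟶ ℙ^N_R` along a ring homomorphism `R → R'`. -/
def baseChange {R R' : Type u} [CommRing R] [CommRing R'] (f : R →+* R') (N : ℕ) :
    space R' N ⟶ space R N :=
  Proj.map (gradedMap f N) (irrelevant_le_map f N)

/-- For an ideal `I` of `A` and a multiplicative set `M`, the part of degree zero of the ideal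
`I · M⁻¹A`, as an ideal of the part of degree zero of `M⁻¹A`. -/
def degreeZeroIdeal {R : Type u} [CommRing R] {N : ℕ}
    (M : Submonoid (MvPolynomial (Fin (N + 1)) R)) (I : Ideal (MvPolynomial (Fin (N + 1)) R)) :
    Ideal (HomogeneousLocalization (grading R N) M) :=
  (I.map (algebraMap _ (Localization M))).comap (algebraMap _ (Localization M))

/-- The ideal sheaf on `Spec A` given by an ideal of `A`. -/
def specIdealSheaf {A : Type u} [CommRing A] (I : Ideal A) :
    (Spec (.of A)).IdealSheafData :=
  .ofIdealTop (I.comap (Scheme.ΓSpecIso (.of A)).hom.hom)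

/-- The ideal sheaf `I~` on `ℙ^N_R` given by a homogeneous ideal `I`, i.e. the closed subscheme
`V(I)` of `ℙ^N_R`: a section is in `I~` if and only if, for each coordinate `X i`, its
restriction to the chart `D₊(X i) = Spec R[X₀, …, X_N]_{(X i)}` is in the ideal `I_{(X i)}`. -/
def idealSheaf {R : Type u} [CommRing R] {N : ℕ} (I : Ideal (MvPolynomial (Fin (N + 1)) R)) :
    (space R N).IdealSheafData :=
  ⨅ i : Fin (N + 1),
    (specIdealSheaf (degreeZeroIdeal (Submonoid.powers (MvPolynomial.X i)) I)).map
      (Proj.awayι (grading R N) (MvPolynomial.X i) (MvPolynomial.isHomogeneous_X R i)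
        Nat.zero_lt_one)

/-- `I` is the saturated ideal of a Cohen-Macaulay monomial multiple structure `Y` on the linear
subspace `X_u = X_v = 0` of `ℙ^N` over `k`. Cohen-Macaulay means locally Cohen-Macaulay: all the
local rings of the closed subscheme `Y = V(I)` are Cohen-Macaulay. The local ring of `Y` at a
point `p` is the quotient of the local ring of `ℙ^N` at `p`, which is the homogeneous
localization at `p`, by the part of degree zero of the extension of `I`. -/
structure IsCMMonomialStructure {k : Type u} [Field k] {N : ℕ} (u v : Fin (N + 1))
    (I : Ideal (MvPolynomial (Fin (N + 1)) k)) : Prop where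
  monomial : ∃ B : Set (Fin (N + 1) →₀ ℕ),
    I = Ideal.span ((fun m => MvPolynomial.monomial m (1 : k)) '' B)
  saturated : ∀ f, (∀ i, MvPolynomial.X i * f ∈ I) → f ∈ I
  radical : I.radical = Ideal.span {MvPolynomial.X u, MvPolynomial.X v}
  cohenMacaulay : ∀ p : ProjectiveSpectrum (grading k N), I ≤ p.asHomogeneousIdeal.toIdeal →
    IsCohenMacaulayLocalRing
      (HomogeneousLocalization.AtPrime (grading k N) p.asHomogeneousIdeal.toIdeal ⧸
        degreeZeroIdeal p.asHomogeneousIdeal.toIdeal.primeCompl I)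

theorem IsCMMonomialStructure.finite_boxes {k : Type u} [Field k] {N : ℕ} {u v : Fin (N + 1)}
    {I : Ideal (MvPolynomial (Fin (N + 1)) k)} (h : IsCMMonomialStructure u v I) :
    {c : ℕ × ℕ | (MvPolynomial.X u ^ c.2 * MvPolynomial.X v ^ c.1 :
      MvPolynomial (Fin (N + 1)) k) ∉ I}.Finite := by
  have hu : (MvPolynomial.X u : MvPolynomial (Fin (N + 1)) k) ∈ I.radical :=
    h.radical ▸ Ideal.subset_span (by simp)
  have hv : (MvPolynomial.X v : MvPolynomial (Fin (N + 1)) k) ∈ I.radical :=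
    h.radical ▸ Ideal.subset_span (by simp)
  obtain ⟨a, ha⟩ := hu
  obtain ⟨b, hb⟩ := hv
  refine ((Finset.range b ×ˢ Finset.range a).finite_toSet).subset ?_
  rintro ⟨s, r⟩ hc
  simp only [Set.mem_ofPred_eq] at hc
  simp only [Finset.coe_product, Finset.coe_range, Set.mem_prod, Set.mem_Iio]
  constructor
  · by_contra! hs
    exact hc (I.mul_mem_left _ (I.mem_of_dvd (pow_dvd_pow _ hs) hb))
  · by_contra! hr
    exact hc (I.mul_mem_right _ (I.mem_of_dvd (pow_dvd_pow _ hr) ha))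

/-- The Young diagram of a Cohen-Macaulay monomial multiple structure: the box in row `s` and
column `r` is in the diagram if and only if the monomial `X_u ^ r * X_v ^ s` is not in `I`. -/
def IsCMMonomialStructure.youngDiagram {k : Type u} [Field k] {N : ℕ} {u v : Fin (N + 1)}
    {I : Ideal (MvPolynomial (Fin (N + 1)) k)} (h : IsCMMonomialStructure u v I) :
    YoungDiagram where
  cells := h.finite_boxes.toFinset
  isLowerSet := by
    rintro ⟨s, r⟩ ⟨s', r'⟩ ⟨h₁, h₂⟩ hc
    simp only [Set.Finite.coe_toFinset, Set.mem_ofPred_eq] at hc ⊢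
    exact fun hI => hc (I.mem_of_dvd (mul_dvd_mul (pow_dvd_pow _ h₂) (pow_dvd_pow _ h₁)) hI)

/-- The monomial ideal with the Young diagram `T`: it is generated by the monomials
`X_u ^ r * X_v ^ s` such that the box in row `s` and column `r` is not in `T`. -/
def diagramIdeal (k : Type u) [Field k] {N : ℕ} (u v : Fin (N + 1)) (T : YoungDiagram) :
    Ideal (MvPolynomial (Fin (N + 1)) k) :=
  Ideal.span {f | ∃ r s : ℕ, (s, r) ∉ T ∧ f = MvPolynomial.X u ^ r * MvPolynomial.X v ^ s}

/-- The substitution `z ↦ t z + (1 - t) x` in `k[x, y, z, …]`, where `x`, `y`, `z` are the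
coordinates with numbers `0`, `1`, `2` and `t` is an element of a `k`-algebra `R`; it fixes all
the other coordinates and has values in `R[x, y, z, …]`. -/
def substitution {k : Type u} [Field k] (n : ℕ) {R : Type u} [CommRing R] [Algebra k R] (t : R) :
    MvPolynomial (Fin (n + 2 + 1)) k →ₐ[k] MvPolynomial (Fin (n + 2 + 1)) R :=
  MvPolynomial.aeval fun i =>
    if i = 2 then MvPolynomial.C t * MvPolynomial.X 2 + MvPolynomial.C (1 - t) * MvPolynomial.X 0
    else MvPolynomial.X i

/-- The union, as closed subschemes of `ℙ^{n+2}_R`, of the multiple structure with ideal `J₁`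
(extended to `R`) and of the multiple structure with ideal `J₂` moved by the substitution
`z ↦ t z + (1 - t) x`. For `R = k[t]` this is the family over the affine line. -/
def unionAt {k : Type u} [Field k] {n : ℕ} (J₁ J₂ : Ideal (MvPolynomial (Fin (n + 2 + 1)) k))
    {R : Type u} [CommRing R] [Algebra k R] (t : R) : (space R (n + 2)).IdealSheafData :=
  idealSheaf (J₁.map (MvPolynomial.map (algebraMap k R))) ⊓
    idealSheaf (J₂.map (substitution n t))

/-- The ideal sheaf of the total space of the family, in `ℙ^{n+2}` over `k[t]`. -/
def family {k : Type u} [Field k] {n : ℕ} (J₁ J₂ : Ideal (MvPolynomial (Fin (n + 2 + 1)) k)) :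
    (space (Polynomial k) (n + 2)).IdealSheafData :=
  unionAt J₁ J₂ (Polynomial.X : Polynomial k)

/-- The fibre of the family over a point `t₀` of the affine line with values in an extension `K`
of `k`, i.e. its base change along `k[t] → K`, `t ↦ t₀`, as a closed subscheme of
`ℙ^{n+2}_K`. -/
def fibre {k : Type u} [Field k] {n : ℕ} (J₁ J₂ : Ideal (MvPolynomial (Fin (n + 2 + 1)) k))
    {K : Type u} [Field K] [Algebra k K] (t₀ : K) : (space K (n + 2)).IdealSheafData :=
  (family J₁ J₂).comap
    (baseChange (Polynomial.aeval t₀ : Polynomial k →ₐ[k] K).toRingHom (n + 2))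

end

end ProjSpace

/-! Everything reduces to the ideals `stairIdeal n t a b`, generated by the products `x ^ a s * ℓ ^
b s * y ^ s` with `ℓ = t z + (1 - t) x`. The Cohen–Macaulay condition excludes embedded components,
so J₁ and J₂ involve only two variables each and are given by their row lengths
(`IsCMMonomialStructure.eq_diagramIdeal`).

When the exponents decrease with `s`, membership in such an ideal is divisibility of each
coefficient in `y` (`mem_stairIdeal_iff`). If `t ≠ 0` in a domain, `x` is prime and does not divide
`ℓ`, so intersecting the two ideals multiplies the generators row by row (`stairIdeal_inf`). This
applies over `k[t]` and to every `t₀ ≠ 0`. The generators of the product form specialize along any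
base change, even to `t = 0`, where `ℓ` becomes `x` and the exponents in each row add.

Flatness over the principal ideal domain `k[t]` is absence of torsion: no prime constant divides `x
^ a * ℓ ^ b`, since the coefficients `t` and `1 - t` of `ℓ` generate the unit ideal
(`mem_stairIdeal_of_C_mul_mem`). The passage from ideals to schemes is made on the standard charts
(`idealSheaf_span_comap_chart`). -/

namespace ProjSpace

/-! ### Ideal sheaves on affine schemes. -/

section Affine

variable {A B : Type u} [CommRing A] [CommRing B]

/-- The ideal of `A` of global sections of an ideal sheaf on `Spec A`. -/
noncomputable def specIdeal (K : (Spec (.of A)).IdealSheafData) : Ideal A :=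
  (K.ideal ⟨⊤, isAffineOpen_top _⟩).comap (Scheme.ΓSpecIso (.of A)).inv.hom

theorem mem_specIdeal {K : (Spec (.of A)).IdealSheafData} {x : A} :
    x ∈ specIdeal K ↔
      (Scheme.ΓSpecIso (.of A)).inv.hom x ∈ K.ideal ⟨⊤, isAffineOpen_top _⟩ :=
  Iff.rfl

theorem specIdealSheaf_le_iff {I : Ideal A} {K : (Spec (.of A)).IdealSheafData} :
    specIdealSheaf I ≤ K ↔ I ≤ specIdeal K := by
  have e : ∀ x, (Scheme.ΓSpecIso (.of A)).inv.hom ((Scheme.ΓSpecIso (.of A)).hom.hom x) = x :=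
    fun x => by simp
  have e' : ∀ x, (Scheme.ΓSpecIso (.of A)).hom.hom ((Scheme.ΓSpecIso (.of A)).inv.hom x) = x :=
    fun x => by simp
  have h : specIdealSheaf I ≤ K ↔ I.comap (Scheme.ΓSpecIso (.of A)).hom.hom ≤
      K.ideal ⟨⊤, isAffineOpen_top _⟩ := by
    constructor
    · intro h
      simpa [specIdealSheaf] using h ⟨⊤, isAffineOpen_top _⟩
    · intro h
      refine Scheme.IdealSheafData.le_of_isAffine ?_
      simpa [specIdealSheaf] using h
  rw [h]
  constructor
  · intro h x hx
    exact h (by simpa [Ideal.mem_comap] using (e' x).symm ▸ hx)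
  · intro h x hx
    have := h hx
    rw [specIdeal, Ideal.mem_comap, e] at this
    exact this

theorem specIdeal_specIdealSheaf (I : Ideal A) : specIdeal (specIdealSheaf I) = I := by
  ext x
  simp [specIdeal, specIdealSheaf]

theorem specIdealSheaf_specIdeal (K : (Spec (.of A)).IdealSheafData) :
    specIdealSheaf (specIdeal K) = K := by
  refine le_antisymm (specIdealSheaf_le_iff.2 le_rfl) ?_
  refine Scheme.IdealSheafData.le_of_isAffine fun x hx => ?_
  simpa [specIdealSheaf, specIdeal] using hx

theorem specIdealSheaf_mono {I J : Ideal A} (h : I ≤ J) :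
    specIdealSheaf I ≤ specIdealSheaf J := by
  rwa [specIdealSheaf_le_iff, specIdeal_specIdealSheaf]

theorem specIdealSheaf_inf (I J : Ideal A) :
    specIdealSheaf (I ⊓ J) = specIdealSheaf I ⊓ specIdealSheaf J := by
  refine le_antisymm
    (le_inf (specIdealSheaf_mono inf_le_left) (specIdealSheaf_mono inf_le_right)) ?_
  rw [← specIdealSheaf_specIdeal (specIdealSheaf I ⊓ specIdealSheaf J)]
  refine specIdealSheaf_mono (le_inf ?_ ?_)
  · rw [← specIdeal_specIdealSheaf I, ← specIdealSheaf_le_iff, specIdealSheaf_specIdeal,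
      specIdeal_specIdealSheaf]
    exact inf_le_left
  · rw [← specIdeal_specIdealSheaf J, ← specIdealSheaf_le_iff, specIdealSheaf_specIdeal,
      specIdeal_specIdealSheaf]
    exact inf_le_right

theorem specIdeal_bot : specIdeal (⊥ : (Spec (.of A)).IdealSheafData) = ⊥ := by
  have : specIdealSheaf (⊥ : Ideal A) = ⊥ :=
    le_bot_iff.1 (specIdealSheaf_le_iff.2 bot_le)
  rw [← this, specIdeal_specIdealSheaf]

theorem specIdeal_map (φ : A →+* B) (K : (Spec (.of B)).IdealSheafData) :
    specIdeal (K.map (Spec.map (CommRingCat.ofHom φ))) = (specIdeal K).comap φ := by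
  ext x
  have h := congr($(Scheme.ΓSpecIso_inv_naturality (CommRingCat.ofHom φ)).hom x)
  rw [Ideal.mem_comap, mem_specIdeal, mem_specIdeal,
    Scheme.IdealSheafData.ideal_map_of_isAffineHom]
  change (Spec.map (CommRingCat.ofHom φ)).appTop.hom
    ((Scheme.ΓSpecIso (.of A)).inv.hom x) ∈ K.ideal ⟨⊤, isAffineOpen_top _⟩ ↔
    (Scheme.ΓSpecIso (.of B)).inv.hom (φ x) ∈ K.ideal ⟨⊤, isAffineOpen_top _⟩
  exact iff_of_eq (congrArg (· ∈ K.ideal ⟨⊤, isAffineOpen_top _⟩) h.symm)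

/-- Pullback is left adjoint to pushforward, and extension of ideals to contraction, so the formula
follows from the one for pushforward, `specIdeal_map`. -/
theorem specIdealSheaf_comap (φ : A →+* B) (I : Ideal A) :
    (specIdealSheaf I).comap (Spec.map (CommRingCat.ofHom φ)) = specIdealSheaf (I.map φ) := by
  have key (K : (Spec (.of B)).IdealSheafData) :
      (specIdealSheaf I).comap (Spec.map (CommRingCat.ofHom φ)) ≤ K ↔
        specIdealSheaf (I.map φ) ≤ K := by
    rw [← Scheme.IdealSheafData.le_map_iff_comap_le, specIdealSheaf_le_iff, specIdeal_map,
      specIdealSheaf_le_iff, Ideal.map_le_iff_le_comap]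
  exact le_antisymm ((key _).2 le_rfl) ((key _).1 le_rfl)

theorem specIdealSheaf_eq_ker (I : Ideal A) :
    specIdealSheaf I = (Spec.map (CommRingCat.ofHom (Ideal.Quotient.mk I))).ker := by
  rw [← Scheme.IdealSheafData.map_bot,
    ← specIdealSheaf_specIdeal (Scheme.IdealSheafData.map ⊥ _), specIdeal_map]
  rw [specIdeal_bot, ← RingHom.ker_eq_comap_bot, Ideal.mk_ker]

end Affine

/-! ### Restriction of ideal sheaves along open immersions. -/

section BaseChange

open Limits

variable {X Y Z : Scheme.{u}}

theorem ker_comap_of_isOpenImmersion (f : X ⟶ Y) [IsOpenImmersion f] (h : Z ⟶ Y)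
    [QuasiCompact h] : h.ker.comap f = (pullback.fst f h).ker := by
  ext U : 2
  rw [Scheme.IdealSheafData.ideal_comap_of_isOpenImmersion]
  exact (Scheme.ker_ideal_of_isPullback_of_isOpenImmersion _ _ _ _
    (IsPullback.of_hasPullback f h) U).symm

/-- A pushforward is the kernel of a composite from the closed subscheme, and kernels of
quasi-compact morphisms commute with restriction to opens. -/
theorem map_comap_of_isOpenImmersion (f : X ⟶ Y) [IsOpenImmersion f] (g : Z ⟶ Y)
    [QuasiCompact g] (I : Z.IdealSheafData) :
    (I.map g).comap f = (I.comap (pullback.snd f g)).map (pullback.fst f g) := by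
  rw [Scheme.IdealSheafData.map, ker_comap_of_isOpenImmersion, Scheme.IdealSheafData.comap,
    ← Scheme.Hom.ker_comp, ← Scheme.Hom.ker_comp_of_isIso
      (pullbackLeftPullbackSndIso f g I.subschemeι).hom]
  simp

theorem iInf_comap_of_isOpenImmersion {ι : Type*} [Finite ι] (f : X ⟶ Y) [IsOpenImmersion f]
    (I : ι → Y.IdealSheafData) : (⨅ i, I i).comap f = ⨅ i, (I i).comap f := by
  ext U x
  simp [Scheme.IdealSheafData.ideal_comap_of_isOpenImmersion,
    Scheme.IdealSheafData.ideal_iInf]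

end BaseChange

/-! ### Homogeneous ideals on the standard charts. -/

section Charts

open HomogeneousLocalization

variable {R : Type u} [CommRing R] {N : ℕ}

theorem X_mem_grading (i : Fin (N + 1)) :
    (MvPolynomial.X i : MvPolynomial (Fin (N + 1)) R) ∈ grading R N 1 :=
  MvPolynomial.isHomogeneous_X R i

variable (R) in
/-- The inclusion of the chart `D₊(X i)` in `ℙ^N`. -/
noncomputable def chart (i : Fin (N + 1)) :
    Spec (.of (Away (grading R N) (MvPolynomial.X i : MvPolynomial _ R))) ⟶ space R N :=
  Proj.awayι (grading R N) (MvPolynomial.X i) (X_mem_grading i) Nat.zero_lt_one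

instance (i : Fin (N + 1)) : IsOpenImmersion (chart R i) := by
  unfold chart
  infer_instance

theorem idealSheaf_eq (I : Ideal (MvPolynomial (Fin (N + 1)) R)) :
    idealSheaf I = ⨅ i : Fin (N + 1),
      (specIdealSheaf (degreeZeroIdeal (Submonoid.powers (MvPolynomial.X i)) I)).map (chart R i) :=
  rfl

/-- The element `f / X i ^ d` of the coordinate ring of the chart `D₊(X i)`, for a form `f` of
degree `d`. -/
noncomputable def dehomogenize (i : Fin (N + 1)) (d : ℕ) (f : MvPolynomial (Fin (N + 1)) R)
    (hf : f ∈ grading R N d) : Away (grading R N) (MvPolynomial.X i : MvPolynomial _ R) :=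
  Away.mk (grading R N) (X_mem_grading i) d f (by simpa using hf)

theorem val_dehomogenize (i : Fin (N + 1)) (d : ℕ) (f : MvPolynomial (Fin (N + 1)) R)
    (hf : f ∈ grading R N d) : (dehomogenize i d f hf).val =
      Localization.mk f (⟨MvPolynomial.X i ^ d, ⟨d, rfl⟩⟩ :
        Submonoid.powers (MvPolynomial.X i : MvPolynomial (Fin (N + 1)) R)) :=
  Away.val_mk ..

theorem dehomogenize_surjective {i : Fin (N + 1)}
    (y : Away (grading R N) (MvPolynomial.X i : MvPolynomial _ R)) :
    ∃ d f hf, y = dehomogenize i d f hf := by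
  obtain ⟨n, f, hf, rfl⟩ := Away.mk_surjective (grading R N) (X_mem_grading i) y
  exact ⟨n, f, by simpa using hf, rfl⟩

theorem mem_degreeZeroIdeal {M : Submonoid (MvPolynomial (Fin (N + 1)) R)}
    {I : Ideal (MvPolynomial (Fin (N + 1)) R)} {y : HomogeneousLocalization (grading R N) M} :
    y ∈ degreeZeroIdeal M I ↔ y.val ∈ I.map (algebraMap _ (Localization M)) :=
  Iff.rfl

theorem mk_mem_map_iff {A : Type*} [CommRing A] {M : Submonoid A} {I : Ideal A} {f : A} {s : M} :
    Localization.mk f s ∈ I.map (algebraMap A (Localization M)) ↔ ∃ m ∈ M, m * f ∈ I := by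
  have h : algebraMap A (Localization M) f = algebraMap A _ (s : A) * Localization.mk f s := by
    rw [Localization.mk_eq_mk', mul_comm, IsLocalization.mk'_spec]
  rw [← Ideal.unit_mul_mem_iff_mem _ (IsLocalization.map_units (Localization M) s), ← h]
  exact IsLocalization.algebraMap_mem_map_algebraMap_iff M _ I f

theorem dehomogenize_mem_degreeZeroIdeal {i : Fin (N + 1)} {d : ℕ}
    {f : MvPolynomial (Fin (N + 1)) R} {hf : f ∈ grading R N d}
    {I : Ideal (MvPolynomial (Fin (N + 1)) R)} :
    dehomogenize i d f hf ∈ degreeZeroIdeal (Submonoid.powers (MvPolynomial.X i)) I ↔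
      ∃ m, MvPolynomial.X i ^ m * f ∈ I := by
  rw [mem_degreeZeroIdeal, val_dehomogenize, mk_mem_map_iff]
  constructor
  · rintro ⟨_, ⟨m, rfl⟩, h⟩
    exact ⟨m, h⟩
  · rintro ⟨m, h⟩
    exact ⟨_, ⟨m, rfl⟩, h⟩

theorem degreeZeroIdeal_inf (M : Submonoid (MvPolynomial (Fin (N + 1)) R))
    (I J : Ideal (MvPolynomial (Fin (N + 1)) R)) :
    degreeZeroIdeal M (I ⊓ J) = degreeZeroIdeal M I ⊓ degreeZeroIdeal M J := by
  ext y
  obtain ⟨c, rfl⟩ := mk_surjective y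
  simp only [Ideal.mem_inf, mem_degreeZeroIdeal, val_mk, mk_mem_map_iff]
  constructor
  · rintro ⟨m, hm, h, h'⟩
    exact ⟨⟨m, hm, h⟩, ⟨m, hm, h'⟩⟩
  · rintro ⟨⟨m, hm, h⟩, ⟨m', hm', h'⟩⟩
    refine ⟨m * m', M.mul_mem hm hm', ?_, ?_⟩
    · rw [mul_right_comm]
      exact I.mul_mem_right _ h
    · rw [mul_assoc]
      exact J.mul_mem_left _ h'

theorem idealSheaf_inf (I J : Ideal (MvPolynomial (Fin (N + 1)) R)) :
    idealSheaf (I ⊓ J) = idealSheaf I ⊓ idealSheaf J := by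
  simp only [idealSheaf, degreeZeroIdeal_inf, specIdealSheaf_inf, Scheme.IdealSheafData.map_inf,
    iInf_inf_eq]

variable {ι : Type*} {g : ι → MvPolynomial (Fin (N + 1)) R} {d : ι → ℕ}

/-- Taking the part of degree `e` of a relation `f = ∑ c a * g a` makes all coefficients
homogeneous; the relation can then be divided by `X i ^ e`. -/
theorem dehomogenize_mem_span (hg : ∀ a, g a ∈ grading R N (d a)) (i : Fin (N + 1))
    {f : MvPolynomial (Fin (N + 1)) R} {e : ℕ} (hf : f ∈ grading R N e)
    (h : f ∈ Ideal.span (Set.range g)) :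
    dehomogenize i e f hf ∈
      Ideal.span (Set.range fun a => dehomogenize i (d a) (g a) (hg a)) := by
  classical
  rw [Ideal.span, Finsupp.mem_span_range_iff_exists_finsupp] at h
  obtain ⟨c, hc⟩ := h
  have key (a : ι) : (DirectSum.decompose (grading R N) (c a * g a) e : MvPolynomial _ R) =
      if d a ≤ e then DirectSum.decompose (grading R N) (c a) (e - d a) * g a else 0 := by
    split_ifs with h
    · exact DirectSum.coe_decompose_mul_of_right_mem_of_le _ (hg a) h
    · exact DirectSum.coe_decompose_mul_of_right_mem_of_not_le _ (hg a) h
  have hsum : dehomogenize i e f hf = ∑ a ∈ c.support, if d a ≤ e then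
      dehomogenize i (e - d a) _
        (SetLike.coe_mem (DirectSum.decompose (grading R N) (c a) (e - d a)))
        * dehomogenize i (d a) (g a) (hg a) else 0 := by
    apply val_injective
    rw [← HomogeneousLocalization.algebraMap_apply, ← HomogeneousLocalization.algebraMap_apply,
      map_sum, HomogeneousLocalization.algebraMap_apply, val_dehomogenize]
    have hf' : f = ∑ a ∈ c.support, (DirectSum.decompose (grading R N) (c a * g a) e :
        MvPolynomial _ R) := by
      rw [← DirectSum.decompose_of_mem_same _ hf, ← hc, Finsupp.sum, DirectSum.decompose_sum,
        DFinsupp.finsetSum_apply, AddSubmonoidClass.coe_finsetSum]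
      rfl
    rw [hf', Localization.mk_sum]
    refine Finset.sum_congr rfl fun a _ => ?_
    rw [key]
    split_ifs with h
    · rw [map_mul, HomogeneousLocalization.algebraMap_apply,
        HomogeneousLocalization.algebraMap_apply, val_dehomogenize, val_dehomogenize,
        Localization.mk_mul]
      congr 1
      ext1
      simp [← pow_add, h]
    · rw [Localization.mk_zero, map_zero]
  rw [hsum]
  refine Ideal.sum_mem _ fun a _ => ?_
  split_ifs
  · exact Ideal.mul_mem_left _ _ (Ideal.subset_span ⟨a, rfl⟩)
  · exact Ideal.zero_mem _

theorem dehomogenize_self_mem (hg : ∀ a, g a ∈ grading R N (d a)) (i : Fin (N + 1)) (a : ι) :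
    dehomogenize i (d a) (g a) (hg a) ∈
      degreeZeroIdeal (Submonoid.powers (MvPolynomial.X i)) (Ideal.span (Set.range g)) :=
  dehomogenize_mem_degreeZeroIdeal.2 ⟨0, by
    rw [pow_zero, one_mul]
    exact Ideal.subset_span (Set.mem_range_self a)⟩

theorem degreeZeroIdeal_span (hg : ∀ a, g a ∈ grading R N (d a)) (i : Fin (N + 1)) :
    degreeZeroIdeal (Submonoid.powers (MvPolynomial.X i)) (Ideal.span (Set.range g)) =
      Ideal.span (Set.range fun a => dehomogenize i (d a) (g a) (hg a)) := by
  refine le_antisymm ?_ ?_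
  · intro y hy
    obtain ⟨n, f, hf, rfl⟩ := dehomogenize_surjective y
    obtain ⟨m, hm⟩ := dehomogenize_mem_degreeZeroIdeal.1 hy
    have hX := SetLike.pow_mem_graded m (X_mem_grading (R := R) i)
    have hd : MvPolynomial.X i ^ m * f ∈ grading R N (m + n) := by
      simpa using SetLike.mul_mem_graded hX hf
    convert dehomogenize_mem_span hg i hd hm using 1
    apply val_injective
    rw [val_dehomogenize, val_dehomogenize, Localization.mk_eq_mk_iff, Localization.r_iff_exists]
    exact ⟨1, by simp only [OneMemClass.coe_one, one_mul]; ring⟩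
  · rw [Ideal.span_le]
    rintro _ ⟨a, rfl⟩
    exact dehomogenize_self_mem hg i a

/-- On the overlap of two charts, `g / X i ^ d = (X j / X i) ^ d * (g / X j ^ d)`. -/
theorem map_awayMap_degreeZeroIdeal_le (hg : ∀ a, g a ∈ grading R N (d a)) (i j : Fin (N + 1)) :
    (degreeZeroIdeal (Submonoid.powers (MvPolynomial.X i)) (Ideal.span (Set.range g))).map
      (awayMap (grading R N) (X_mem_grading j) rfl) ≤
    (degreeZeroIdeal (Submonoid.powers (MvPolynomial.X j)) (Ideal.span (Set.range g))).map
      (awayMap (grading R N) (X_mem_grading i)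
        (mul_comm (MvPolynomial.X i) (MvPolynomial.X j))) := by
  rw [degreeZeroIdeal_span hg i, Ideal.map_span, Ideal.span_le]
  rintro _ ⟨_, ⟨a, rfl⟩, rfl⟩
  have h := Ideal.mem_map_of_mem (awayMap (grading R N) (X_mem_grading i)
    (mul_comm (MvPolynomial.X i) (MvPolynomial.X j))) (dehomogenize_self_mem hg j a)
  -- The factor `(X j / X i) ^ d` is written with denominator `(X i * X j) ^ d`, hence numerator `X
  -- j ^ (2 * d)`.
  have hx : (MvPolynomial.X j ^ (2 * d a) : MvPolynomial (Fin (N + 1)) R) ∈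
      grading R N (d a • (1 + 1)) := by
    convert SetLike.pow_mem_graded (2 * d a) (X_mem_grading (R := R) j) using 1
    simp only [smul_eq_mul, mul_one]
    rw [mul_comm]
  have e : awayMap (grading R N) (X_mem_grading j) rfl (dehomogenize i (d a) (g a) (hg a)) =
      Away.mk (grading R N) (SetLike.mul_mem_graded (X_mem_grading i) (X_mem_grading j))
        (d a) _ hx *
      awayMap (grading R N) (X_mem_grading i) (mul_comm (MvPolynomial.X i) (MvPolynomial.X j))
        (dehomogenize j (d a) (g a) (hg a)) := by
    rw [dehomogenize, dehomogenize, awayMap_mk, awayMap_mk]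
    apply val_injective
    rw [val_mul, Away.val_mk, Away.val_mk, Away.val_mk, Localization.mk_mul,
      Localization.mk_eq_mk_iff, Localization.r_iff_exists]
    refine ⟨1, ?_⟩
    simp
    ring
  exact e ▸ Ideal.mul_mem_left _ _ h

/-- The sheaf is an infimum of pushforwards from all charts. On chart `i` the term from chart `j`
imposes nothing new, because the two local ideals agree on the overlap. -/
theorem idealSheaf_span_comap_chart (hg : ∀ a, g a ∈ grading R N (d a)) (i : Fin (N + 1)) :
    (idealSheaf (Ideal.span (Set.range g))).comap (chart R i) =
    specIdealSheaf (degreeZeroIdeal (Submonoid.powers (MvPolynomial.X i))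
      (Ideal.span (Set.range g))) := by
  rw [idealSheaf_eq, iInf_comap_of_isOpenImmersion]
  refine le_antisymm ((iInf_le _ i).trans (Scheme.IdealSheafData.comap_map_le _ _))
    (le_iInf fun j => ?_)
  have hqc : QuasiCompact (chart (N := N) R j) := inferInstance
  rw [map_comap_of_isOpenImmersion, Scheme.IdealSheafData.le_map_iff_comap_le]
  let e : Limits.pullback (chart R i) (chart R j) ≅ _ :=
    Proj.pullbackAwayιIso (grading R N) (X_mem_grading i) Nat.zero_lt_one
      (X_mem_grading j) Nat.zero_lt_one rfl
  have h₁ : e.inv ≫ Limits.pullback.fst (chart R i) (chart R j) = _ :=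
    Proj.pullbackAwayιIso_inv_fst (grading R N) (X_mem_grading i) Nat.zero_lt_one
    (X_mem_grading j) Nat.zero_lt_one rfl
  have h₂ : e.inv ≫ Limits.pullback.snd (chart R i) (chart R j) = _ :=
    Proj.pullbackAwayιIso_inv_snd (grading R N) (X_mem_grading i) Nat.zero_lt_one
    (X_mem_grading j) Nat.zero_lt_one rfl
  have key := specIdealSheaf_mono (map_awayMap_degreeZeroIdeal_le hg i j)
  rw [← specIdealSheaf_comap, ← specIdealSheaf_comap, ← h₁, ← h₂,
    Scheme.IdealSheafData.comap_comp, Scheme.IdealSheafData.comap_comp] at key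
  have := Scheme.IdealSheafData.comap_mono e.hom key
  simpa only [← Scheme.IdealSheafData.comap_comp, Iso.hom_inv_id_assoc] using this

end Charts

/-! ### Base change and flatness, checked on charts. -/

section ChartCover

open HomogeneousLocalization

variable {R : Type u} [CommRing R] {N : ℕ}

variable (R N) in
theorem irrelevant_le_span_X : (HomogeneousIdeal.irrelevant (grading R N)).toIdeal ≤
    Ideal.span (Set.range MvPolynomial.X) := by
  rw [HomogeneousIdeal.toIdeal_irrelevant_le]
  intro d hd p hp
  rw [← Set.image_univ, Submodule.mem_toAddSubmonoid, MvPolynomial.mem_ideal_span_X_image]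
  intro m hm
  have hdeg : m.degree = d := by
    have := hp (MvPolynomial.mem_support_iff.mp hm)
    rwa [Finsupp.degree_eq_weight_one]
  by_contra! h
  have : m = 0 := Finsupp.ext fun i => h i (Set.mem_univ i)
  subst this
  simp at hdeg
  omega

theorem iSup_opensRange_chart : ⨆ i, (chart (N := N) R i).opensRange = ⊤ := by
  rw [← Proj.iSup_basicOpen_eq_top (grading R N) _ (irrelevant_le_span_X R N)]
  congr! 2 with i
  exact Proj.opensRange_awayι ..

theorem idealSheafData_ext_chart {I J : (space R N).IdealSheafData}
    (h : ∀ i, I.comap (chart R i) = J.comap (chart R i)) : I = J := by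
  refine Scheme.IdealSheafData.ext_of_iSup_eq_top
    (fun i => ⟨chart R i ''ᵁ ⊤, (isAffineOpen_top _).image_of_isOpenImmersion _⟩) ?_ fun i => ?_
  · simpa using iSup_opensRange_chart
  · have := congr(($(h i)).ideal ⟨⊤, isAffineOpen_top _⟩)
    rw [Scheme.IdealSheafData.ideal_comap_of_isOpenImmersion,
      Scheme.IdealSheafData.ideal_comap_of_isOpenImmersion] at this
    exact Ideal.comap_injective_of_surjective _
      (ConcreteCategory.bijective_of_isIso ((chart R i).appIso ⊤).inv).2 this

variable {R' : Type u} [CommRing R']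

theorem exists_chart_comp_baseChange (f : R →+* R') (i : Fin (N + 1)) :
    ∃ φ : Away (grading R N) (MvPolynomial.X i : MvPolynomial _ R) →+*
        Away (grading R' N) (MvPolynomial.X i : MvPolynomial _ R'),
      chart R' i ≫ baseChange f N = Spec.map (CommRingCat.ofHom φ) ≫ chart R i ∧
      ∀ d g hg, φ (dehomogenize i d g hg) =
        dehomogenize i d (MvPolynomial.map f g) (MvPolynomial.IsHomogeneous.map hg f) := by
  -- The image of `X i` is only propositionally `X i`, and the target ring depends on it;
  -- generalizing to `s` allows substitution.
  have key (s : MvPolynomial (Fin (N + 1)) R') (hs : gradedMap f N (MvPolynomial.X i) = s)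
      (hs' : s ∈ grading R' N 1) :
      ∃ φ : Away (grading R N) (MvPolynomial.X i : MvPolynomial _ R) →+* Away (grading R' N) s,
      Proj.awayι (grading R' N) s hs' Nat.zero_lt_one ≫ baseChange f N =
        Spec.map (CommRingCat.ofHom φ) ≫ chart R i ∧
      ∀ d g hg, φ (dehomogenize i d g hg) =
        Away.mk (grading R' N) hs' d (MvPolynomial.map f g)
          (by simpa using MvPolynomial.IsHomogeneous.map hg f) := by
    subst hs
    refine ⟨Away.map (gradedMap f N) _, Proj.awayι_comp_map _ _ Nat.zero_lt_one _
      (X_mem_grading i), fun d g hg => ?_⟩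
    exact Away.map_mk ..
  exact key _ (MvPolynomial.map_X f i) (X_mem_grading i)

variable {ι : Type*} {g : ι → MvPolynomial (Fin (N + 1)) R} {d : ι → ℕ}

theorem idealSheaf_span_comap_baseChange (hg : ∀ a, g a ∈ grading R N (d a)) (f : R →+* R') :
    (idealSheaf (Ideal.span (Set.range g))).comap (baseChange f N) =
      idealSheaf (Ideal.span (Set.range fun a => MvPolynomial.map f (g a))) := by
  have hg' (a) : MvPolynomial.map f (g a) ∈ grading R' N (d a) :=
    MvPolynomial.IsHomogeneous.map (hg a) f
  refine idealSheafData_ext_chart fun i => ?_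
  obtain ⟨φ, hφ, hφ'⟩ := exists_chart_comp_baseChange (N := N) f i
  rw [idealSheaf_span_comap_chart hg', ← Scheme.IdealSheafData.comap_comp, hφ,
    Scheme.IdealSheafData.comap_comp, idealSheaf_span_comap_chart hg, specIdealSheaf_comap,
    degreeZeroIdeal_span hg, degreeZeroIdeal_span hg', Ideal.map_span, ← Set.range_comp]
  congr 3
  ext1 a
  exact hφ' ..

variable (R) in
/-- The structure homomorphism of the coordinate ring of the chart `D₊(X i)`. -/
noncomputable def chartRingHom (i : Fin (N + 1)) :
    R →+* Away (grading R N) (MvPolynomial.X i : MvPolynomial _ R) :=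
  (fromZeroRingHom (grading R N) _).comp (algebraMap R (grading R N 0))

theorem chart_comp_toSpec (i : Fin (N + 1)) :
    chart R i ≫ toSpec R N = Spec.map (CommRingCat.ofHom (chartRingHom R i)) := by
  rw [toSpec, chart, Proj.awayι_toSpecZero_assoc, ← Spec.map_comp]
  rfl

theorem respectsIso_of_isZariskiLocalAtSource (P : MorphismProperty Scheme.{u})
    [IsZariskiLocalAtSource P] : P.RespectsIso :=
  inferInstance

/-- Flatness is local on the source, and over chart `i` the subscheme is the spectrum of the
quotient by `J i`. -/
theorem flat_subschemeι_of_chart {I : (space R N).IdealSheafData}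
    {J : ∀ i, Ideal (Away (grading R N) (MvPolynomial.X i : MvPolynomial _ R))}
    (hJ : ∀ i, I.comap (chart R i) = specIdealSheaf (J i))
    (hflat : ∀ i, ((Ideal.Quotient.mk (J i)).comp (chartRingHom R i)).Flat) :
    Flat (I.subschemeι ≫ toSpec R N) := by
  let 𝒰 : (space R N).AffineOpenCover := Proj.affineOpenCoverOfIrrelevantLESpan (grading R N)
    (fun i : Fin (N + 1) => MvPolynomial.X i) (fun i => X_mem_grading i)
    (fun _ => Nat.zero_lt_one) (irrelevant_le_span_X R N)
  have hloc : IsZariskiLocalAtSource (@Flat : MorphismProperty Scheme.{u}) :=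
    HasRingHomProperty.instIsZariskiLocalAtSource
  have hiso : MorphismProperty.RespectsIso (@Flat : MorphismProperty Scheme.{u}) :=
    respectsIso_of_isZariskiLocalAtSource _
  rw [hloc.iff_of_openCover (𝒰.openCover.pullback₁ I.subschemeι)]
  refine fun i : Fin (N + 1) => ?_
  change Flat (Limits.pullback.fst I.subschemeι (chart R i) ≫ I.subschemeι ≫ toSpec R N)
  rw [Limits.pullback.condition_assoc, chart_comp_toSpec,
    ← Limits.pullbackSymmetry_hom_comp_fst_assoc,
    ← Scheme.IdealSheafData.comapIso_inv_subschemeι_assoc,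
    MorphismProperty.cancel_left_of_respectsIso @Flat,
    MorphismProperty.cancel_left_of_respectsIso @Flat, hJ, specIdealSheaf_eq_ker]
  let q := Spec.map (CommRingCat.ofHom (Ideal.Quotient.mk (J i)))
  have : IsClosedImmersion q := IsClosedImmersion.spec_of_surjective _ Ideal.Quotient.mk_surjective
  rw [← MorphismProperty.cancel_left_of_respectsIso @Flat q.toImage,
    Scheme.Hom.toImage_imageι_assoc, ← Spec.map_comp, Flat.SpecMap_iff]
  exact hflat i

end ChartCover

end ProjSpace

/-! ### Divisibility criteria. -/

section Polynomial

variable {A : Type*} [CommRing A]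

/-- The divisibility conditions define an ideal: coefficient `s` of a product `a * f` involves only
`f.coeff j` with `j ≤ s`, and `c s ∣ c j` for these. -/
theorem Polynomial.mem_span_C_mul_X_pow_iff {c : ℕ → A} (hc : ∀ s, c (s + 1) ∣ c s)
    (f : Polynomial A) :
    f ∈ Ideal.span (Set.range fun s => Polynomial.C (c s) * Polynomial.X ^ s) ↔
      ∀ s, c s ∣ f.coeff s := by
  have hc' : ∀ a b, c (a + b) ∣ c a := by
    intro a b
    induction b with
    | zero => rfl
    | succ b ih => exact (hc (a + b)).trans ih
  constructor
  · intro hf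
    refine Submodule.span_induction ?_ ?_ ?_ ?_ hf
    · rintro _ ⟨a, rfl⟩ s
      rw [Polynomial.coeff_C_mul_X_pow]
      split_ifs with h
      · rw [h]
      · exact dvd_zero _
    · simp
    · intro f g _ _ hf hg s
      exact (hf s).add (hg s)
    · intro a f _ hf s
      rw [smul_eq_mul, Polynomial.coeff_mul]
      refine Finset.dvd_sum fun x hx => Dvd.dvd.mul_left ?_ _
      rw [← Finset.HasAntidiagonal.mem_antidiagonal.1 hx, add_comm]
      exact (hc' _ _).trans (hf _)
  · intro hf
    rw [f.as_sum_support_C_mul_X_pow]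
    refine Ideal.sum_mem _ fun s _ => ?_
    obtain ⟨b, hb⟩ := hf s
    rw [hb, mul_comm (c s), Polynomial.C_mul, mul_assoc]
    exact Ideal.mul_mem_left _ _ (Ideal.subset_span ⟨s, rfl⟩)

end Polynomial

section Dvd

variable {A : Type*} [CommRing A] [IsDomain A]

theorem Prime.pow_mul_dvd_iff {x l : A} (hx : Prime x) (hl : ¬ x ∣ l) (a b : ℕ) (f : A) :
    x ^ a * l ^ b ∣ f ↔ x ^ a ∣ f ∧ l ^ b ∣ f := by
  refine ⟨fun h => ⟨(dvd_mul_right _ _).trans h, (dvd_mul_left _ _).trans h⟩, ?_⟩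
  rintro ⟨h, g, rfl⟩
  rw [mul_comm]
  exact mul_dvd_mul_left _ (hx.pow_dvd_of_dvd_mul_left a (fun h => hl (hx.dvd_of_dvd_pow h)) h)

theorem Prime.dvd_of_dvd_mul_of_not_dvd {p c f : A} (hp : Prime p) (hc : ¬ p ∣ c)
    (h : c ∣ p * f) : c ∣ f := by
  obtain ⟨b, hb⟩ := h
  obtain ⟨b', rfl⟩ := (hp.dvd_or_dvd (hb ▸ dvd_mul_right p f)).resolve_left hc
  exact ⟨b', mul_left_cancel₀ hp.ne_zero (by rw [hb]; ring)⟩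

end Dvd

/-! ### The ideal of the union: intersection and torsion. -/

namespace ProjSpace

section Union

open MvPolynomial

variable {R : Type u} [CommRing R] {n : ℕ}

/-- The polynomial ring in `x, y, z, …` as the ring of polynomials in `y` over the polynomial
ring in the other variables. -/
noncomputable def polynomialInY (R : Type u) [CommRing R] (n : ℕ) :
    MvPolynomial (Fin (n + 2 + 1)) R ≃ₐ[R] Polynomial (MvPolynomial (Fin (n + 2)) R) :=
  (renameEquiv R (Equiv.swap 0 1)).trans (finSuccEquiv R (n + 2))

theorem polynomialInY_C (r : R) : polynomialInY R n (C r) = Polynomial.C (C r) := by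
  simp [polynomialInY, finSuccEquiv_apply]

theorem polynomialInY_X (i : Fin (n + 2 + 1)) :
    polynomialInY R n (X i) = finSuccEquiv R (n + 2) (X (Equiv.swap 0 1 i)) := by
  rw [polynomialInY, AlgEquiv.trans_apply, renameEquiv_apply, rename_X]

theorem polynomialInY_X_zero : polynomialInY R n (X 0) = Polynomial.C (X 0) := by
  rw [polynomialInY_X, Equiv.swap_apply_left, ← Fin.succ_zero_eq_one, finSuccEquiv_X_succ]

theorem polynomialInY_X_one : polynomialInY R n (X 1) = Polynomial.X := by
  rw [polynomialInY_X, Equiv.swap_apply_right, finSuccEquiv_X_zero]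

theorem polynomialInY_X_two : polynomialInY R n (X 2) = Polynomial.C (X 1) := by
  rw [polynomialInY_X, ← Fin.succ_one_eq_two, Equiv.swap_apply_of_ne_of_ne (Fin.succ_ne_zero _),
    finSuccEquiv_X_succ]
  rw [← Fin.succ_zero_eq_one]
  exact fun h => zero_ne_one' (Fin (n + 2)) (Fin.succ_injective _ h).symm

/-- The linear form `t z + (1 - t) x`. -/
noncomputable def movedForm (n : ℕ) (t : R) : MvPolynomial (Fin (n + 2 + 1)) R :=
  C t * X 2 + C (1 - t) * X 0

/-- The linear form `t z + (1 - t) x` in the polynomial ring without the variable `y`. -/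
noncomputable def movedFormWithoutY (n : ℕ) (t : R) : MvPolynomial (Fin (n + 2)) R :=
  C t * X 1 + C (1 - t) * X 0

theorem polynomialInY_movedForm (t : R) :
    polynomialInY R n (movedForm n t) = Polynomial.C (movedFormWithoutY n t) := by
  simp [movedForm, movedFormWithoutY, polynomialInY_C, polynomialInY_X_zero, polynomialInY_X_two]

/-- The ideal generated by the products `x ^ a s * (t z + (1 - t) x) ^ b s * y ^ s`. -/
noncomputable def stairIdeal (n : ℕ) (t : R) (a b : ℕ → ℕ) :
    Ideal (MvPolynomial (Fin (n + 2 + 1)) R) :=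
  Ideal.span (Set.range fun s => X 0 ^ a s * movedForm n t ^ b s * X 1 ^ s)

theorem mem_stairIdeal_iff {t : R} {a b : ℕ → ℕ} (ha : Antitone a) (hb : Antitone b)
    (f : MvPolynomial (Fin (n + 2 + 1)) R) :
    f ∈ stairIdeal n t a b ↔
      ∀ s, X 0 ^ a s * movedFormWithoutY n t ^ b s ∣ (polynomialInY R n f).coeff s := by
  rw [← Polynomial.mem_span_C_mul_X_pow_iff (c := fun s => X 0 ^ a s * movedFormWithoutY n t ^ b s)
    (fun s => mul_dvd_mul (pow_dvd_pow _ (ha s.le_succ)) (pow_dvd_pow _ (hb s.le_succ)))]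
  have h : Ideal.span (Set.range fun s =>
      Polynomial.C (X 0 ^ a s * movedFormWithoutY n t ^ b s) * Polynomial.X ^ s) =
      (stairIdeal n t a b).map (polynomialInY R n) := by
    rw [stairIdeal, Ideal.map_span, ← Set.range_comp]
    congr 2
    ext1 s
    simp [polynomialInY_X_zero, polynomialInY_X_one, polynomialInY_movedForm]
  rw [h]
  refine ⟨Ideal.mem_map_of_mem _, fun hf => ?_⟩
  obtain ⟨g, hg, hgf⟩ := (Ideal.mem_map_iff_of_surjective _ (polynomialInY R n).surjective).1 hf
  rwa [← (polynomialInY R n).injective hgf]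

theorem coeff_movedFormWithoutY_zero (t : R) :
    coeff (Finsupp.single 0 1) (movedFormWithoutY n t) = 1 - t := by
  rw [movedFormWithoutY, coeff_add, coeff_C_mul, coeff_C_mul]
  simp [coeff_X, Finsupp.single_left_inj]

theorem coeff_movedFormWithoutY_one (t : R) :
    coeff (Finsupp.single 1 1) (movedFormWithoutY n t) = t := by
  rw [movedFormWithoutY, coeff_add, coeff_C_mul, coeff_C_mul]
  simp [coeff_X, Finsupp.single_left_inj]

variable [IsDomain R]

/-- In each power of `y`, divisibility by `x ^ a s` and by `ℓ ^ b s` together is divisibility by the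
product, as `x` is a prime not dividing `ℓ`. -/
theorem stairIdeal_inf {t : R} (ht : t ≠ 0) {a b : ℕ → ℕ} (ha : Antitone a) (hb : Antitone b) :
    stairIdeal n t a 0 ⊓ stairIdeal n t 0 b = stairIdeal n t a b := by
  -- The monomial `z` has coefficient `t ≠ 0` in the moved form but coefficient zero in any multiple
  -- of `x`.
  have hdvd : ¬ (X 0 : MvPolynomial (Fin (n + 2)) R) ∣ movedFormWithoutY n t := by
    intro h
    obtain ⟨q, hq⟩ := h
    have h := coeff_movedFormWithoutY_one (n := n) t
    rw [hq, coeff_X_mul'] at h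
    exact ht (by simpa [Finsupp.single_apply] using h.symm)
  ext f
  have h₀ : Antitone (0 : ℕ → ℕ) := antitone_const
  rw [Ideal.mem_inf, mem_stairIdeal_iff ha h₀, mem_stairIdeal_iff h₀ hb, mem_stairIdeal_iff ha hb]
  simp [(X_prime (i := (0 : Fin (n + 2)))).pow_mul_dvd_iff hdvd, forall_and]

/-- The quotient has no torsion over `R`: the prime factors of `r` are cancelled one at a time,
since none divides `x ^ a s * ℓ ^ b s`. -/
theorem mem_stairIdeal_of_C_mul_mem [UniqueFactorizationMonoid R] {t : R} {a b : ℕ → ℕ}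
    (ha : Antitone a) (hb : Antitone b) {r : R} (hr : r ≠ 0)
    {f : MvPolynomial (Fin (n + 2 + 1)) R} (h : C r * f ∈ stairIdeal n t a b) :
    f ∈ stairIdeal n t a b := by
  induction r using UniqueFactorizationMonoid.induction_on_prime generalizing f with
  | h₁ => exact absurd rfl hr
  | h₂ x hx => exact (Ideal.unit_mul_mem_iff_mem _ (hx.map C)).1 h
  | h₃ r p hr' hp ih =>
    refine ih hr' ?_
    rw [C_mul, mul_assoc] at h
    have hpC : Prime (C p : MvPolynomial (Fin (n + 2)) R) := (prime_C_iff _).2 hp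
    rw [mem_stairIdeal_iff ha hb] at h ⊢
    intro s
    refine hpC.dvd_of_dvd_mul_of_not_dvd (fun hd => ?_)
      (by simpa [polynomialInY_C] using h s)
    rcases hpC.dvd_or_dvd hd with hd | hd <;> replace hd := hpC.dvd_of_dvd_pow hd <;>
      rw [C_dvd_iff_dvd_coeff] at hd
    · exact hp.not_dvd_one (by simpa using hd (Finsupp.single 0 1))
    -- A prime constant dividing the moved form would divide both `1 - t` and `t`, hence their sum
    -- `1`.
    · have h₀ := hd (Finsupp.single 0 1)
      have h₁ := hd (Finsupp.single 1 1)
      rw [coeff_movedFormWithoutY_zero] at h₀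
      rw [coeff_movedFormWithoutY_one] at h₁
      exact hp.not_dvd_one (by simpa using h₀.add h₁)

end Union

end ProjSpace

/-! ### Cohen–Macaulay monomial ideals have no embedded components. -/

/-- A Cohen-Macaulay local ring whose maximal ideal kills a nonzero element has dimension zero. -/
theorem IsCohenMacaulayLocalRing.isNilpotent_of_mem_nonunits {A : Type u} [CommRing A]
    (h : IsCohenMacaulayLocalRing A) {a : A} (ha : a ≠ 0) (hann : ∀ r ∈ nonunits A, r * a = 0)
    {z : A} (hz : z ∈ nonunits A) : IsNilpotent z := by
  obtain ⟨-, hloc, rs, hrs, hreg, hdim⟩ := h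
  cases rs with
  | nil =>
    have : Ring.KrullDimLE 0 A := Ring.krullDimLE_iff.2 (by simp [hdim])
    have hm : z ∈ IsLocalRing.maximalIdeal A := hz
    rwa [← IsLocalRing.jacobson_eq_maximalIdeal ⊥ bot_ne_top, Ideal.jacobson_bot,
      Ring.jacobson_eq_nilradical_of_krullDimLE_zero, mem_nilradical] at hm
  -- The first element of a nonempty regular sequence would be a nonzerodivisor, yet it kills `a`.
  | cons r rs =>
    rw [RingTheory.Sequence.isRegular_cons_iff] at hreg
    refine absurd (hreg.1 ?_) ha
    simpa using hann r (hrs r (by simp))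

namespace MvPolynomial

variable {σ R : Type*} [CommRing R]

theorem span_X_image_eq_ker (s : Set σ) [DecidablePred (· ∈ s)] :
    Ideal.span (X '' s : Set (MvPolynomial σ R)) =
      RingHom.ker (aeval (R := R) fun i => if i ∈ s then (0 : MvPolynomial σ R) else X i) := by
  refine le_antisymm ?_ fun f hf => ?_
  · rw [Ideal.span_le]
    rintro _ ⟨i, hi, rfl⟩
    simp [RingHom.mem_ker, hi]
  · have h : (Ideal.Quotient.mkₐ R (Ideal.span (X '' s : Set (MvPolynomial σ R)))).comp
        (aeval (R := R) fun i => if i ∈ s then (0 : MvPolynomial σ R) else X i) =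
        Ideal.Quotient.mkₐ R _ := by
      ext i
      by_cases hi : i ∈ s
      · have : (X i : MvPolynomial σ R) ∈ Ideal.span (X '' s) :=
          Ideal.subset_span ⟨i, hi, rfl⟩
        simpa [hi] using (Ideal.Quotient.eq_zero_iff_mem.2 this).symm
      · simp [hi]
    rw [RingHom.mem_ker] at hf
    have := congr($h f)
    rw [AlgHom.comp_apply] at this
    rw [← Ideal.Quotient.eq_zero_iff_mem]
    change Ideal.Quotient.mkₐ R _ f = 0
    rw [← this, show (aeval fun i => if i ∈ s then (0 : MvPolynomial σ R) else X i) f = 0 from hf,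
      map_zero]

theorem isPrime_span_X_image [IsDomain R] (s : Set σ) :
    (Ideal.span (X '' s : Set (MvPolynomial σ R))).IsPrime := by
  classical
  rw [span_X_image_eq_ker]
  exact RingHom.ker_isPrime _

theorem X_mem_span_X_image_iff [Nontrivial R] {s : Set σ} {i : σ} :
    (X i : MvPolynomial σ R) ∈ Ideal.span (X '' s : Set (MvPolynomial σ R)) ↔ i ∈ s := by
  rw [mem_ideal_span_X_image]
  constructor
  · intro h
    obtain ⟨j, hj, h⟩ := h (Finsupp.single i 1) (by simp)
    rwa [(Finsupp.single_apply_ne_zero.1 h).1] at hj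
  · intro h m hm
    rw [support_X, Finset.mem_singleton] at hm
    exact ⟨i, h, by simp [hm]⟩

/-- A monomial ideal contains the monomials of its elements. -/
theorem monomial_mem_of_mem_support {I : Ideal (MvPolynomial σ R)}
    (hI : ∃ B : Set (σ →₀ ℕ), I = Ideal.span ((fun m => monomial m (1 : R)) '' B))
    {f : MvPolynomial σ R} (hf : f ∈ I) {m : σ →₀ ℕ} (hm : m ∈ f.support) :
    monomial m (1 : R) ∈ I := by
  obtain ⟨B, rfl⟩ := hI
  rw [mem_ideal_span_monomial_image] at hf ⊢
  intro x hx
  rw [Finset.mem_singleton.1 (support_monomial_subset hx)]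
  exact hf m hm

/-- A maximal element among the annihilators `I : X ^ m` which do not lie in the ideal of the
variables with indices in `t` is generated by variables. -/
theorem exists_monomial_colon_eq_span_X [Finite σ] [IsNoetherianRing R] [IsDomain R]
    {I : Ideal (MvPolynomial σ R)}
    (hI : ∃ B : Set (σ →₀ ℕ), I = Ideal.span ((fun m => monomial m (1 : R)) '' B)) (t : Set σ)
    {m w : σ →₀ ℕ} (hm : monomial m (1 : R) ∉ I) (hmw : monomial (m + w) (1 : R) ∈ I)
    (hw : ∀ i ∈ t, w i = 0) :
    ∃ (m : σ →₀ ℕ) (s : Set σ), ¬ s ⊆ t ∧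
      ∀ f, monomial m (1 : R) * f ∈ I ↔ f ∈ Ideal.span (X '' s : Set (MvPolynomial σ R)) := by
  let Q (m : σ →₀ ℕ) : Ideal (MvPolynomial σ R) :=
    Submodule.comap (LinearMap.mulLeft (MvPolynomial σ R) (monomial m (1 : R))) I
  have hQ (m f) : f ∈ Q m ↔ monomial m (1 : R) * f ∈ I := Iff.rfl
  -- `S` collects the monomials outside `I` that some monomial free of the variables in `t` carries
  -- into `I`; noetherianity gives one with maximal colon ideal `Q m`.
  let S : Set (σ →₀ ℕ) := {m | monomial m (1 : R) ∉ I ∧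
    ∃ w, monomial (m + w) (1 : R) ∈ I ∧ ∀ i ∈ t, w i = 0}
  obtain ⟨_, ⟨m, ⟨hm, w, hmw, hw⟩, rfl⟩, hmax⟩ :=
    (wellFounded_gt (α := Ideal (MvPolynomial σ R))).has_min (Q '' S) ⟨_, m, ⟨hm, w, hmw, hw⟩, rfl⟩
  let s : Set σ := {i | X i * monomial m (1 : R) ∈ I}
  have hXm (i : σ) (m : σ →₀ ℕ) :
      X i * monomial m (1 : R) = monomial (Finsupp.single i 1 + m) 1 := by
    rw [X, monomial_mul, one_mul]
  -- If `X i ∉ Q m`, then `X i` times the monomial is again in `S` with a colon ideal containing `Q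
  -- m`. Maximality makes the two equal, so `X i` is a nonzerodivisor modulo `Q m`.
  have hreg (i) (hi : i ∉ s) (f) (hf : X i * f ∈ Q m) : f ∈ Q m := by
    have hle : Q m ≤ Q (Finsupp.single i 1 + m) := by
      intro g hg
      rw [hQ, ← hXm, mul_assoc]
      exact I.mul_mem_left _ hg
    have hS : Finsupp.single i 1 + m ∈ S := by
      refine ⟨by rwa [← hXm], w, ?_, hw⟩
      rw [add_assoc, ← hXm]
      exact I.mul_mem_left _ hmw
    rw [hle.eq_of_not_lt (hmax _ ⟨_, hS, rfl⟩), hQ, ← hXm, mul_assoc, mul_left_comm]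
    exact hf
  -- Variables outside `s` are cancelled by `hreg`; were there no variable from `s`, this would end
  -- with `1 ∈ Q m`.
  have hmon (w : σ →₀ ℕ) : monomial w (1 : R) ∈ Q m → ∃ i ∈ s, w i ≠ 0 := by
    induction hn : w.degree generalizing w with
    | zero =>
      intro h
      rw [Finsupp.degree_eq_zero_iff] at hn
      rw [hn, hQ, monomial_mul, one_mul, add_zero] at h
      exact absurd h hm
    | succ n ih =>
      intro h
      obtain ⟨i, hi⟩ : ∃ i, w i ≠ 0 := by
        by_contra! h
        rw [show w = 0 from Finsupp.ext h] at hn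
        simp at hn
      by_cases his : i ∈ s
      · exact ⟨i, his, hi⟩
      have hw' : Finsupp.single i 1 + (w - Finsupp.single i 1) = w :=
        add_tsub_cancel_of_le (Finsupp.single_le_iff.2 (Nat.one_le_iff_ne_zero.2 hi))
      rw [← hw', ← hXm] at h
      rw [← hw', map_add, Finsupp.degree_single] at hn
      obtain ⟨j, hj, hwj⟩ := ih (w - Finsupp.single i 1) (by omega) (hreg i his _ h)
      refine ⟨j, hj, fun h0 => hwj ?_⟩
      rw [Finsupp.tsub_apply, h0, zero_tsub]
  refine ⟨m, s, ?_, fun f => ⟨fun hf => ?_, fun hf => ?_⟩⟩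
  · intro hst
    obtain ⟨i, hi, hwi⟩ := hmon w (by rwa [hQ, monomial_mul, one_mul])
    exact hwi (hw i (hst hi))
  · rw [mem_ideal_span_X_image]
    intro w hw
    refine hmon w ?_
    rw [hQ, monomial_mul, one_mul]
    refine monomial_mem_of_mem_support hI hf ?_
    rw [mem_support_iff] at hw ⊢
    rwa [coeff_monomial_mul, one_mul]
  · suffices h : Ideal.span (X '' s : Set (MvPolynomial σ R)) ≤ Q m from h hf
    rw [Ideal.span_le]
    rintro _ ⟨i, hi, rfl⟩
    rw [SetLike.mem_coe, hQ, mul_comm]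
    exact hi

end MvPolynomial

namespace ProjSpace

open MvPolynomial HomogeneousLocalization

variable {k : Type u} [Field k] {N : ℕ} {u v : Fin (N + 1)}
  {I : Ideal (MvPolynomial (Fin (N + 1)) k)}

theorem mk_mem_degreeZeroIdeal_iff {R : Type u} [CommRing R]
    {M : Submonoid (MvPolynomial (Fin (N + 1)) R)} {I : Ideal (MvPolynomial (Fin (N + 1)) R)}
    {c : NumDenSameDeg (grading R N) M} :
    HomogeneousLocalization.mk c ∈ degreeZeroIdeal M I ↔
      ∃ s ∈ M, s * (c.num : MvPolynomial (Fin (N + 1)) R) ∈ I := by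
  rw [mem_degreeZeroIdeal, val_mk, mk_mem_map_iff]

/-- The relevant homogeneous prime ideal generated by a set of variables which does not contain
all the variables. -/
noncomputable def coordinatePoint (k : Type u) [Field k] {N : ℕ} {s : Set (Fin (N + 1))}
    {l : Fin (N + 1)} (hl : l ∉ s) : ProjectiveSpectrum (grading k N) where
  asHomogeneousIdeal := ⟨Ideal.span (X '' s), Ideal.homogeneous_span _ _ (by
    rintro _ ⟨i, -, rfl⟩
    exact ⟨1, X_mem_grading i⟩)⟩
  isPrime := isPrime_span_X_image s
  not_irrelevant_le h := hl <| X_mem_span_X_image_iff.1 <|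
    h (HomogeneousIdeal.mem_irrelevant_of_mem _ Nat.zero_lt_one (X_mem_grading l))

/-- Variables other than `X u` and `X v` are nonzerodivisors on monomials modulo `I`. Otherwise `I`
has an associated prime generated by variables, one of them outside `{u, v}`; the local ring there
has depth zero, so dimension zero by Cohen–Macaulayness, which contradicts the radical of `I`. -/
theorem IsCMMonomialStructure.apply_ne_zero_of_monomial_add_mem
    (h : IsCMMonomialStructure u v I) {m w : Fin (N + 1) →₀ ℕ}
    (hm : MvPolynomial.monomial m (1 : k) ∉ I) (hmw : MvPolynomial.monomial (m + w) (1 : k) ∈ I) :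
    w u ≠ 0 ∨ w v ≠ 0 := by
  by_contra! hw
  obtain ⟨m, s, hs, hms⟩ := exists_monomial_colon_eq_span_X h.monomial {u, v} hm hmw (by simp [hw])
  obtain ⟨j, hjs, hj⟩ := Set.not_subset.1 hs
  -- Saturation rules out the irrelevant ideal, so the prime is a point of projective space and `X
  -- l` can serve as denominator.
  obtain ⟨l, hl⟩ : ∃ l, l ∉ s := by
    by_contra! hall
    have h1 : MvPolynomial.monomial m (1 : k) ∈ I := h.saturated _ fun i => by
      rw [mul_comm, hms]
      exact Ideal.subset_span ⟨i, hall i, rfl⟩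
    rw [← mul_one (MvPolynomial.monomial m (1 : k)), hms] at h1
    exact (isPrime_span_X_image s).ne_top ((Ideal.eq_top_iff_one _).2 h1)
  set P := coordinatePoint k hl
  have hIP : I ≤ P.asHomogeneousIdeal.toIdeal := fun f hf => (hms f).1 (I.mul_mem_left _ hf)
  have hrad : I.radical = Ideal.span (X '' {u, v}) := by
    rw [h.radical, Set.image_pair]
  have hradP : I.radical ≤ P.asHomogeneousIdeal.toIdeal :=
    (P.isPrime.radical_le_iff).2 hIP
  have hlP : (X l : MvPolynomial _ k) ∉ P.asHomogeneousIdeal.toIdeal :=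
    fun h => hl (X_mem_span_X_image_iff.1 h)
  have hpow (d : ℕ) : (X l ^ d : MvPolynomial _ k) ∈ P.asHomogeneousIdeal.toIdeal.primeCompl :=
    fun h => hlP (P.isPrime.mem_of_pow_mem _ h)
  have hpowd (d : ℕ) : (X l ^ d : MvPolynomial _ k) ∈ grading k N d := by
    simpa using SetLike.pow_mem_graded d (X_mem_grading (R := k) l)
  let q := Ideal.Quotient.mk (degreeZeroIdeal P.asHomogeneousIdeal.toIdeal.primeCompl I)
  let a : HomogeneousLocalization.AtPrime (grading k N) P.asHomogeneousIdeal.toIdeal :=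
    .mk ⟨m.degree, ⟨MvPolynomial.monomial m 1, isHomogeneous_monomial _ rfl⟩,
      ⟨_, hpowd m.degree⟩, hpow _⟩
  let z : HomogeneousLocalization.AtPrime (grading k N) P.asHomogeneousIdeal.toIdeal :=
    .mk ⟨1, ⟨X j, X_mem_grading j⟩, ⟨_, hpowd 1⟩, hpow _⟩
  -- The class of `X ^ m / X l ^ m.degree` survives at `P` because the colon ideal of `X ^ m` is
  -- exactly `P`; for the same reason the maximal ideal kills it.
  have ha : q a ≠ 0 := by
    rw [Ne, Ideal.Quotient.eq_zero_iff_mem, mk_mem_degreeZeroIdeal_iff]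
    rintro ⟨s, hs, hsI⟩
    rw [mul_comm] at hsI
    exact hs ((hms _).1 hsI)
  have hann : ∀ r ∈ nonunits _, r * q a = 0 := by
    intro r hr
    obtain ⟨r, rfl⟩ := Ideal.Quotient.mk_surjective r
    obtain ⟨c, rfl⟩ := HomogeneousLocalization.mk_surjective r
    have hc : (c.num : MvPolynomial _ k) ∈ P.asHomogeneousIdeal.toIdeal := by
      by_contra hc
      refine hr (IsUnit.map q ?_)
      rw [← isUnit_iff_isUnit_val, val_mk, Localization.mk_eq_mk']
      exact (IsLocalization.AtPrime.isUnit_mk'_iff _ P.asHomogeneousIdeal.toIdeal _ _).2 hc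
    rw [← map_mul, Ideal.Quotient.eq_zero_iff_mem, ← mk_mul, mk_mem_degreeZeroIdeal_iff]
    refine ⟨1, one_mem _, ?_⟩
    rw [one_mul, NumDenSameDeg.num_mul, mul_comm]
    exact (hms _).2 hc
  have hz : q z ∈ nonunits _ := by
    intro hu
    refine ha (hu.mul_right_eq_zero.1 ?_)
    rw [← map_mul, Ideal.Quotient.eq_zero_iff_mem, ← mk_mul, mk_mem_degreeZeroIdeal_iff]
    refine ⟨1, one_mem _, ?_⟩
    rw [one_mul, NumDenSameDeg.num_mul, mul_comm]
    exact (hms _).2 (Ideal.subset_span ⟨j, hjs, rfl⟩)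
  -- Nilpotence of `X j / X l` gives `f * X j ^ e ∈ I` with `f ∉ P`. The radical is prime and
  -- contained in `P`, so it contains `X j`, against the choice of `j`.
  obtain ⟨e, he⟩ := (h.cohenMacaulay P hIP).isNilpotent_of_mem_nonunits ha hann hz
  rw [← map_pow, Ideal.Quotient.eq_zero_iff_mem, ← mk_pow, mk_mem_degreeZeroIdeal_iff] at he
  obtain ⟨f, hf, hfI⟩ := he
  have hpr := isPrime_span_X_image (R := k) {u, v}
  have hfr := Ideal.le_radical hfI
  rw [hrad] at hfr
  rcases hpr.mem_or_mem hfr with hfr | hfr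
  · exact hf (hradP (hrad ▸ hfr))
  · rw [NumDenSameDeg.num_pow] at hfr
    exact hj (X_mem_span_X_image_iff.1 (hpr.mem_of_pow_mem _ hfr))

/-- Erasing the variables other than `X u` and `X v` from a monomial generator leaves a monomial of
`I`, by the absence of embedded components. -/
theorem IsCMMonomialStructure.eq_diagramIdeal (h : IsCMMonomialStructure u v I) (huv : u ≠ v) :
    I = diagramIdeal k u v h.youngDiagram := by
  have hT (r s : ℕ) : (s, r) ∉ h.youngDiagram ↔
      (X u ^ r * X v ^ s : MvPolynomial (Fin (N + 1)) k) ∈ I := by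
    rw [← YoungDiagram.mem_cells]
    simp [IsCMMonomialStructure.youngDiagram]
  refine le_antisymm ?_ ?_
  · obtain ⟨B, hB⟩ := h.monomial
    conv_lhs => rw [hB]
    rw [Ideal.span_le]
    rintro _ ⟨b, hb, rfl⟩
    have hbI : MvPolynomial.monomial b (1 : k) ∈ I := hB ▸ Ideal.subset_span ⟨b, hb, rfl⟩
    let m : Fin (N + 1) →₀ ℕ := Finsupp.single u (b u) + Finsupp.single v (b v)
    have hmu : m u = b u := by simp [m, Finsupp.single_eq_of_ne huv]
    have hmv : m v = b v := by simp [m, Finsupp.single_eq_of_ne huv.symm]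
    have hmb : m ≤ b := by
      intro i
      by_cases hi : i = u
      · rw [hi, hmu]
      by_cases hi' : i = v
      · rw [hi', hmv]
      simp [m, Finsupp.single_eq_of_ne hi, Finsupp.single_eq_of_ne hi']
    have hmm : (X u ^ b u * X v ^ b v : MvPolynomial (Fin (N + 1)) k) =
        MvPolynomial.monomial m 1 := by
      rw [X_pow_eq_monomial, X_pow_eq_monomial, monomial_mul, one_mul]
    have hmI : MvPolynomial.monomial m (1 : k) ∈ I := by
      by_contra hm
      rcases h.apply_ne_zero_of_monomial_add_mem hm (w := b - m)
        (by rwa [add_tsub_cancel_of_le hmb]) with h | h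
      · simp [hmu] at h
      · simp [hmv] at h
    have hmd : MvPolynomial.monomial m (1 : k) ∈ diagramIdeal k u v h.youngDiagram :=
      Ideal.subset_span ⟨b u, b v, (hT _ _).2 (hmm ▸ hmI), hmm.symm⟩
    refine Ideal.mem_of_dvd _ ?_ hmd
    exact monomial_dvd_monomial.2 ⟨Or.inr hmb, dvd_rfl⟩
  · rw [diagramIdeal, Ideal.span_le]
    rintro _ ⟨r, s, hrs, rfl⟩
    exact (hT r s).1 hrs

theorem diagramIdeal_eq_span_range (T : YoungDiagram) :
    diagramIdeal k u v T = Ideal.span (Set.range fun s => X u ^ T.rowLen s * X v ^ s) := by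
  refine le_antisymm ?_ ?_
  · rw [diagramIdeal, Ideal.span_le]
    rintro _ ⟨r, s, hrs, rfl⟩
    rw [YoungDiagram.mem_iff_lt_rowLen, not_lt] at hrs
    exact Ideal.mem_of_dvd _ (mul_dvd_mul_right (pow_dvd_pow _ hrs) _)
      (Ideal.subset_span ⟨s, rfl⟩)
  · rw [Ideal.span_le]
    rintro _ ⟨s, rfl⟩
    exact Ideal.subset_span ⟨_, s, by simp [YoungDiagram.mem_iff_lt_rowLen], rfl⟩

/-! ### The family and its fibres. -/

open MvPolynomial HomogeneousLocalization

section Family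

variable {R : Type u} [CommRing R] {n : ℕ}

theorem stairIdeal_generator_mem_grading (t : R) (a b : ℕ → ℕ) (s : ℕ) :
    X 0 ^ a s * movedForm n t ^ b s * X 1 ^ s ∈ grading R (n + 2) (a s + b s + s) := by
  have hX (i : Fin (n + 2 + 1)) : (X i : MvPolynomial _ R).IsHomogeneous 1 := isHomogeneous_X R i
  have hL : (movedForm n t).IsHomogeneous 1 :=
    ((hX 2).C_mul t).add ((hX 0).C_mul (1 - t))
  simpa using (((hX 0).pow (a s)).mul (hL.pow (b s))).mul ((hX 1).pow s)

theorem map_movedForm {R' : Type u} [CommRing R'] (f : R →+* R') (t : R) :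
    MvPolynomial.map f (movedForm n t) = movedForm n (f t) := by
  simp [movedForm]

theorem idealSheaf_stairIdeal_comap_baseChange {R' : Type u} [CommRing R'] (f : R →+* R') (t : R)
    (a b : ℕ → ℕ) :
    (idealSheaf (stairIdeal n t a b)).comap (baseChange f (n + 2)) =
      idealSheaf (stairIdeal n (f t) a b) := by
  rw [stairIdeal, idealSheaf_span_comap_baseChange (stairIdeal_generator_mem_grading t a b),
    stairIdeal]
  simp [map_movedForm]

theorem stairIdeal_zero (a b : ℕ → ℕ) :
    stairIdeal n (0 : R) a b = Ideal.span (Set.range fun s => X 0 ^ (a s + b s) * X 1 ^ s) := by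
  simp [stairIdeal, movedForm, pow_add]

/-- Over a principal ideal domain flat means torsion-free, and torsion on a chart lifts to torsion
modulo `I` after multiplication by a power of `X i`. -/
theorem flat_mk_comp_chartRingHom [IsDomain R] [IsPrincipalIdealRing R] {N : ℕ}
    {I : Ideal (MvPolynomial (Fin (N + 1)) R)}
    (hI : ∀ r : R, r ≠ 0 → ∀ f, C r * f ∈ I → f ∈ I) (i : Fin (N + 1)) :
    ((Ideal.Quotient.mk (degreeZeroIdeal (Submonoid.powers (X i)) I)).comp
      (chartRingHom R i)).Flat := by
  set φ := (Ideal.Quotient.mk (degreeZeroIdeal (Submonoid.powers (X i)) I)).comp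
    (chartRingHom R i)
  let := φ.toAlgebra
  change Module.Flat R _
  rw [Module.Flat.flat_iff_torsion_eq_bot_of_isBezout, eq_bot_iff]
  rintro y ⟨⟨r, hr⟩, h⟩
  replace h : φ r * y = 0 := h
  obtain ⟨y, rfl⟩ := Ideal.Quotient.mk_surjective y
  obtain ⟨d, f, hf, rfl⟩ := dehomogenize_surjective y
  have hCf : C r * f ∈ grading R N d := by
    simpa using IsHomogeneous.C_mul (r := r) hf
  have e : chartRingHom R i r * dehomogenize i d f hf = dehomogenize i d (C r * f) hCf := by
    apply val_injective
    rw [val_mul, val_dehomogenize, val_dehomogenize]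
    change Localization.mk (C r) 1 * _ = _
    rw [Localization.mk_mul, one_mul]
  rw [RingHom.comp_apply, ← map_mul, e, Ideal.Quotient.eq_zero_iff_mem,
    dehomogenize_mem_degreeZeroIdeal] at h
  obtain ⟨m, hm⟩ := h
  rw [Submodule.mem_bot, Ideal.Quotient.eq_zero_iff_mem, dehomogenize_mem_degreeZeroIdeal]
  exact ⟨m, hI r (nonZeroDivisors.ne_zero hr) _ (by rwa [mul_left_comm])⟩

theorem flat_stairIdeal [IsDomain R] [IsPrincipalIdealRing R] (t : R) {a b : ℕ → ℕ}
    (ha : Antitone a) (hb : Antitone b) :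
    Flat ((idealSheaf (stairIdeal n t a b)).subschemeι ≫ toSpec R (n + 2)) :=
  flat_subschemeι_of_chart
    (fun i => idealSheaf_span_comap_chart (stairIdeal_generator_mem_grading t a b) i)
    (fun i => flat_mk_comp_chartRingHom
      (fun _ hr _ => mem_stairIdeal_of_C_mul_mem ha hb hr) i)

variable {k : Type u} [Field k] [Algebra k R] {J₁ J₂ : Ideal (MvPolynomial (Fin (n + 2 + 1)) k)}

theorem two_ne_one_of_fin (n : ℕ) : (2 : Fin (n + 2 + 1)) ≠ 1 := by
  rw [← Fin.succ_one_eq_two, ← Fin.succ_zero_eq_one]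
  exact fun h => zero_ne_one' (Fin (n + 2)) (Fin.succ_injective _ h).symm

/-- The parameter `t` is arbitrary because the moved form occurs with exponent zero; this puts both
components in the form needed by `stairIdeal_inf`. -/
theorem map_algebraMap_eq_stairIdeal (h₁ : IsCMMonomialStructure 0 1 J₁) (t : R) :
    J₁.map (MvPolynomial.map (algebraMap k R)) = stairIdeal n t h₁.youngDiagram.rowLen 0 := by
  conv_lhs => rw [h₁.eq_diagramIdeal (zero_ne_one' _), diagramIdeal_eq_span_range, Ideal.map_span]
  simp [stairIdeal, ← Set.range_comp, Function.comp_def]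

theorem map_substitution_eq_stairIdeal (h₂ : IsCMMonomialStructure 2 1 J₂) (t : R) :
    J₂.map (substitution n t) = stairIdeal n t 0 h₂.youngDiagram.rowLen := by
  have hX2 : substitution (k := k) n t (X 2) = movedForm n t := by
    simp [substitution, movedForm]
  have hX1 : substitution (k := k) n t (X 1) = X 1 := by
    simp [substitution, (two_ne_one_of_fin n).symm]
  conv_lhs => rw [h₂.eq_diagramIdeal (two_ne_one_of_fin n), diagramIdeal_eq_span_range,
    Ideal.map_span]
  simp [stairIdeal, ← Set.range_comp, Function.comp_def, hX1, hX2]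

theorem unionAt_eq_idealSheaf_stairIdeal [IsDomain R] (h₁ : IsCMMonomialStructure 0 1 J₁)
    (h₂ : IsCMMonomialStructure 2 1 J₂) {t : R} (ht : t ≠ 0) :
    unionAt J₁ J₂ t =
      idealSheaf (stairIdeal n t h₁.youngDiagram.rowLen h₂.youngDiagram.rowLen) := by
  rw [unionAt, map_algebraMap_eq_stairIdeal h₁ t, map_substitution_eq_stairIdeal h₂,
    ← idealSheaf_inf, stairIdeal_inf ht (fun _ _ => YoungDiagram.rowLen_anti _ _ _)
      (fun _ _ => YoungDiagram.rowLen_anti _ _ _)]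

/-- The intersection is computed over `k[t]`, where the parameter is nonzero, and only then
specialized. Hence `t₀ = 0` is allowed, although `stairIdeal_inf` does not apply at that value. -/
theorem fibre_eq_idealSheaf_stairIdeal (h₁ : IsCMMonomialStructure 0 1 J₁)
    (h₂ : IsCMMonomialStructure 2 1 J₂) {K : Type u} [Field K] [Algebra k K] (t₀ : K) :
    fibre J₁ J₂ t₀ =
      idealSheaf (stairIdeal n t₀ h₁.youngDiagram.rowLen h₂.youngDiagram.rowLen) := by
  rw [fibre, family, unionAt_eq_idealSheaf_stairIdeal h₁ h₂ Polynomial.X_ne_zero,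
    idealSheaf_stairIdeal_comap_baseChange]
  congr 2
  exact Polynomial.aeval_X t₀

end Family

end ProjSpace

theorem proposition4p8 (k : Type u) [Field k] (n : ℕ)
    (J₁ J₂ : Ideal (MvPolynomial (Fin (n + 2 + 1)) k))
    (h₁ : ProjSpace.IsCMMonomialStructure 0 1 J₁)
    (h₂ : ProjSpace.IsCMMonomialStructure 2 1 J₂) :
    Flat ((ProjSpace.family J₁ J₂).subschemeι ≫ ProjSpace.toSpec (Polynomial k) (n + 2)) ∧
    ∀ (K : Type u) [Field K] [Algebra k K],
      (∀ t₀ : K, t₀ ≠ 0 → ProjSpace.fibre J₁ J₂ t₀ = ProjSpace.unionAt J₁ J₂ t₀) ∧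
      ProjSpace.fibre J₁ J₂ (0 : K) =
        ProjSpace.idealSheaf
          (ProjSpace.diagramIdeal K 0 1 (h₁.youngDiagram.rowSum h₂.youngDiagram)) := by
  refine ⟨?_, fun K _ _ => ⟨fun t₀ ht₀ => ?_, ?_⟩⟩
  · rw [ProjSpace.family,
      ProjSpace.unionAt_eq_idealSheaf_stairIdeal h₁ h₂ Polynomial.X_ne_zero]
    exact ProjSpace.flat_stairIdeal _ (fun _ _ => YoungDiagram.rowLen_anti _ _ _)
      (fun _ _ => YoungDiagram.rowLen_anti _ _ _)
  · rw [ProjSpace.fibre_eq_idealSheaf_stairIdeal h₁ h₂,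
      ProjSpace.unionAt_eq_idealSheaf_stairIdeal h₁ h₂ ht₀]
  · rw [ProjSpace.fibre_eq_idealSheaf_stairIdeal h₁ h₂, ProjSpace.stairIdeal_zero,
      ProjSpace.diagramIdeal_eq_span_range]
    simp only [YoungDiagram.rowLen_rowSum]
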